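/- Let $\omega=(1+i\sqrt3)/2$ and $\mathbb T_6=\{\omega^k : k\in\mathbb Z\}$. A signed digraph $\Phi=(G,\varphi)$ consists of a finite simple graph $G$ and gains $\varphi(uv)\in\mathbb T_6$ for all ordered pairs $uv$ of adjacent vertices, with $\varphi(vu)=\varphi(uv)^{-1}$. (The gains $1,-1,\omega,-\omega$ of $uv$ represent a positive digon, a negative digon, a positive arc and a negative arc from $u$ to $v$, respectively.) Its Eisenstein matrix $\mathcal E(\Phi)$ is the Hermitian matrix with entry $\varphi(uv)$ at $(u,v)$ if $u,v$ are adjacent, and $0$ otherwise. Two signed digraphs are cospectral if their Eisenstein matrices have the same characteristic polynomial. They are switching isomorphic if one may be obtained from the other by a sequence of gain switchings $\mathcal E\mapsto X\mathcal E X^{-1}$ ($X$ diagonal with diagonal entries in $\mathbb T_6$) and relabelings of the vertices, possibly followed by taking the converse (reversal of all arcs, that is, $\mathcal E\mapsto \mathcal E^{\top}$). A signed digraph $\Phi$ is determined by its Eisenstein spectrum (DES) if every signed digraph cospectral to $\Phi$ is switching isomorphic to $\Phi$. Let $K_n$ be the complete graph on $n$ vertices with all gains equal to $1$. For $n\ge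 2$, let $K_n^*$ be obtained from $K_n$ by orienting exactly one edge: for one pair of distinct vertices $a,b$ the gains become $\varphi(ab)=\omega$ and $\varphi(ba)=\omega^{-1}$, while all other gains remain $1$. For a signed digraph $\Phi$, let $-\Phi$ be obtained from it by multiplying all gains by $-1$. **Proposition.** For every $n$, both $K_n$ and $-K_n$ are DES. For every $n\ge 2$, both $K_n^*$ and $-K_n^*$ are DES. -/

import Mathlib

universe u v

noncomputable section

/-- The unit Eisenstein integer `ω = (1 + i√3)/2 = exp(iπ/3)`. -/
def eisensteinOmega : ℂ := (1 + Complex.I * (Real.sqrt 3 : ℝ)) / 2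

theorem eisensteinOmega_pow_six : eisensteinOmega ^ 6 = 1 := by
  have h3 : ((Real.sqrt 3 : ℝ) : ℂ) ^ 2 = 3 := by
    rw [← Complex.ofReal_pow, Real.sq_sqrt (by norm_num)]
    norm_num
  have hq : eisensteinOmega ^ 2 = eisensteinOmega - 1 := by
    unfold eisensteinOmega
    linear_combination (((Real.sqrt 3 : ℝ) : ℂ) ^ 2 / 4) * Complex.I_sq - (1 / 4) * h3
  have hc : eisensteinOmega ^ 3 = -1 := by
    linear_combination (eisensteinOmega + 1) * hq
  linear_combination (eisensteinOmega ^ 3 - 1) * hc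

/-- The gain group `𝕋₆` of sixth roots of unity in `ℂ`, that is `{exp(ikπ/3) : k ∈ ℤ}`. -/
abbrev T6 : Type := rootsOfUnity 6 ℂ

/-- `ω` as an element of `𝕋₆`. -/
def T6.omega : T6 := rootsOfUnity.mkOfPowEq eisensteinOmega eisensteinOmega_pow_six

/-- `-1` as an element of `𝕋₆`. -/
def T6.negOne : T6 := rootsOfUnity.mkOfPowEq (-1 : ℂ) (by norm_num)

/-- A signed digraph on the vertex set `V`, in the form of a `𝕋₆`-gain graph: a simple underlying
graph together with a gain in `𝕋₆` for every arc `uv` of the associated symmetric digraph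
(a dart of the graph), such that the gains of `uv` and `vu` are mutually inverse.
The gains `1`, `-1`, `ω`, `-ω` of `uv` stand for a positive digon, a negative digon, a positive
arc from `u` to `v`, and a negative arc from `u` to `v`. -/
structure SignedDigraph (V : Type u) where
  graph : SimpleGraph V
  gain : graph.Dart → T6
  gain_symm : ∀ d : graph.Dart, gain d.symm = (gain d)⁻¹

namespace SignedDigraph

variable {V : Type u} {W : Type v}

open scoped Classical in
/-- The Eisenstein matrix: the gain of `uv` if `uv` is an arc, and `0` otherwise. -/
def eisenstein (Φ : SignedDigraph V) : Matrix V V ℂ :=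
  fun a b => if h : Φ.graph.Adj a b then ((Φ.gain ⟨(a, b), h⟩ : ℂˣ) : ℂ) else 0

/-- The converse: all arcs are reversed, and signs are kept. -/
def converse (Φ : SignedDigraph V) : SignedDigraph V where
  graph := Φ.graph
  gain d := Φ.gain d.symm
  gain_symm d := Φ.gain_symm d.symm

/-- The negative `-Φ`: all gains are multiplied by `-1`. -/
def neg (Φ : SignedDigraph V) : SignedDigraph V where
  graph := Φ.graph
  gain d := T6.negOne * Φ.gain d
  gain_symm d := by
    have h : T6.negOne⁻¹ = T6.negOne := by
      rw [inv_eq_iff_mul_eq_one]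
      ext
      simp [T6.negOne]
    rw [Φ.gain_symm, mul_inv, h]

/-- `Ψ` arises from `Φ` by renaming the vertices along the bijection `e`. -/
def IsRelabeling (e : V ≃ W) (Φ : SignedDigraph V) (Ψ : SignedDigraph W) : Prop :=
  Ψ.eisenstein = Matrix.reindex e e Φ.eisenstein

section Finite

variable [Fintype V] [DecidableEq V] [Fintype W] [DecidableEq W]

/-- `Ψ` is obtained from `Φ` by a gain switching: `𝓔(Ψ) = X 𝓔(Φ) X⁻¹` for a diagonal matrix `X`
with diagonal entries in `𝕋₆`. -/
def IsGainSwitching (Φ Ψ : SignedDigraph V) : Prop :=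
  ∃ x : V → T6, Ψ.eisenstein =
    Matrix.diagonal (fun i => ((x i : ℂˣ) : ℂ)) * Φ.eisenstein *
      (Matrix.diagonal (fun i => ((x i : ℂˣ) : ℂ)))⁻¹

/-- `Ψ` is obtained from `Φ` by a permutation of the vertices: `𝓔(Ψ) = P 𝓔(Φ) Pᵀ` for a
permutation matrix `P`. -/
def IsVertexPermutation (Φ Ψ : SignedDigraph V) : Prop :=
  ∃ σ : Equiv.Perm V, Ψ.eisenstein =
    σ.permMatrix ℂ * Φ.eisenstein * (σ.permMatrix ℂ).transpose

/-- Switching isomorphism `Φ ∼ Ψ`: after an identification of the vertex sets, `Ψ` or its converse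
is obtained from `Φ` by a sequence of gain switchings and vertex permutations. -/
def SwitchingIsomorphic (Φ : SignedDigraph V) (Ψ : SignedDigraph W) : Prop :=
  ∃ (e : V ≃ W) (Φ₀ Φ₁ : SignedDigraph W),
    IsRelabeling e Φ Φ₀ ∧
    Relation.ReflTransGen (fun A B => IsGainSwitching A B ∨ IsVertexPermutation A B) Φ₀ Φ₁ ∧
    (Ψ = Φ₁ ∨ Ψ = Φ₁.converse)

/-- Two signed digraphs are cospectral if the characteristic polynomials of their Eisenstein
matrices coincide. -/
def Cospectral (Φ : SignedDigraph V) (Ψ : SignedDigraph W) : Prop :=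
  Φ.eisenstein.charpoly = Ψ.eisenstein.charpoly

/-- `Φ` is determined by its Eisenstein spectrum: it is switching isomorphic to every (finite)
signed digraph that is cospectral to it. -/
def IsDES (Φ : SignedDigraph V) : Prop :=
  ∀ (W : Type v) [Fintype W] [DecidableEq W] (Ψ : SignedDigraph W),
    Cospectral Φ Ψ → SwitchingIsomorphic Φ Ψ

end Finite

/-- The complete graph `K_n` on the vertex set `V`: all pairs of distinct vertices are joined by
positive digons. -/
def complete (V : Type u) : SignedDigraph V where
  graph := ⊤
  gain _ := 1
  gain_symm _ := by simp

open scoped Classical in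
/-- The digraph `K_n^*`: the complete graph in which the edge between the two distinct vertices
`a` and `b`, and no other one, is oriented, from `a` to `b`. -/
def completeStar (a b : V) (hab : a ≠ b) : SignedDigraph V where
  graph := ⊤
  gain d :=
    if d.toProd = (a, b) then T6.omega
    else if d.toProd = (b, a) then T6.omega⁻¹
    else 1
  gain_symm d := by
    obtain ⟨⟨c, e⟩, h⟩ := d
    simp only [SimpleGraph.Dart.symm_mk, Prod.swap_prod_mk, Prod.mk.injEq]
    by_cases h1 : c = a ∧ e = b
    · obtain ⟨rfl, rfl⟩ := h1
      simp [hab, hab.symm]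
    · by_cases h2 : c = b ∧ e = a
      · obtain ⟨rfl, rfl⟩ := h2
        simp [hab, hab.symm]
      · have h3 : ¬ (e = a ∧ c = b) := fun h => h2 ⟨h.2, h.1⟩
        have h4 : ¬ (e = b ∧ c = a) := fun h => h1 ⟨h.2, h.1⟩
        simp [h1, h2, h3, h4]

end SignedDigraph

end

open Finset

/-! ### Traces of powers of Hermitian matrices -/

/-! The second and third spectral moments already suffice. The trace of the square counts adjacent
ordered pairs, so a signed digraph `Ψ` cospectral to a complete one is complete. The trace of the
cube then fixes the deficit: the sum of `1 - Re g` over ordered triples of distinct vertices, `g`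
being the triangle gain. A sixth root of unity other than `1` has real part at most `1/2`, so each
unbalanced triangle costs at least `6 · 1/2 = 3`.

For `K_n` the deficit is `0`: all triangles are balanced, and switching at one vertex makes all
gains `1`.

For `K_n^*` the deficit is `3(n - 2)`, so at most `n - 2` triangles are unbalanced. The gains of a
tetrahedron's faces are multiplicatively dependent, so an unbalanced triangle `S` and a vertex `d ∉
S` give another unbalanced triangle through `d` in `S ∪ {d}` (`exchange_unbalancedSets`). This
produces `n - 3` further triangles, so equality holds throughout: the unbalanced triangles are those
on a common edge `ab` (`exists_common_pair_of_exchange`), with gains `ω` or its conjugate. Switching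
at the third vertex `c` of one of them leaves `ab` as the only edge with gain other than `1`.

Negation preserves the second moment and changes the sign of the third, which gives the negatives.
-/

theorem Matrix.IsHermitian.trace_pow_eq_sum_eigenvalues {𝕜 n : Type*} [RCLike 𝕜] [Fintype n]
    [DecidableEq n] {A : Matrix n n 𝕜} (hA : A.IsHermitian) (k : ℕ) :
    (A ^ k).trace = ∑ i, (hA.eigenvalues i : 𝕜) ^ k := by
  conv_lhs => rw [hA.spectral_theorem, ← map_pow, Matrix.diagonal_pow,
    Unitary.conjStarAlgAut_apply, Matrix.trace_mul_cycle, Unitary.coe_star_mul_self, one_mul]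
  simp [Matrix.trace]

theorem Matrix.IsHermitian.trace_pow_eq_of_charpoly_eq {𝕜 n : Type*} [RCLike 𝕜] [Fintype n]
    [DecidableEq n] {A B : Matrix n n 𝕜} (hA : A.IsHermitian) (hB : B.IsHermitian)
    (h : A.charpoly = B.charpoly) (k : ℕ) : (A ^ k).trace = (B ^ k).trace := by
  rw [hA.trace_pow_eq_sum_eigenvalues, hB.trace_pow_eq_sum_eigenvalues,
    (hA.eigenvalues_eq_eigenvalues_iff hB).2 h]

/-! ### Families of triples -/

/-- If every exchange point `d ∉ S` of a member `S` of a family of at most `n - 2` triples yields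
a member inside `insert d S` through `d`, then there are exactly `n - 2` triples, and they are all
the triples through some pair. -/
theorem exists_common_pair_of_exchange {W : Type*} [Fintype W] [DecidableEq W]
    (T : Finset (Finset W)) (h3 : ∀ S ∈ T, S.card = 3) (hT : T.card + 2 ≤ Fintype.card W)
    (hex : ∀ S ∈ T, ∀ d ∉ S, ∃ S' ∈ T, d ∈ S' ∧ S' ⊆ insert d S) (hne : T.Nonempty) :
    T.card + 2 = Fintype.card W ∧
      ∃ a b c, a ≠ b ∧ a ≠ c ∧ b ≠ c ∧ {a, b, c} ∈ T ∧ ∀ S ∈ T, a ∈ S ∧ b ∈ S := by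
  have key : ∀ S ∈ T, T.card + 2 = Fintype.card W ∧
      (∀ S' ∈ T, S' ≠ S → ∃ d ∉ S, d ∈ S' ∧ S' ⊆ insert d S) ∧
      ∀ S' ∈ T, ∀ S'' ∈ T, ∀ d ∉ S, d ∈ S' → d ∈ S'' → S' = S'' := by
    intro S hS
    -- `f d` meets the complement of `S` only in `d`, so `f` is injective. It maps `n - 3` points
    -- into the at most `n - 3` members other than `S`, hence is a bijection onto them.
    choose! f hfT hfd hfs using hex S hS
    have hmaps : Set.MapsTo f (Sᶜ : Finset W) (T.erase S : Finset (Finset W)) := by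
      intro d hd
      have hd' : d ∉ S := by simpa using hd
      simp only [coe_erase, Set.mem_sdiff, mem_coe, Set.mem_singleton_iff]
      exact ⟨hfT d hd', fun h => hd' (h ▸ hfd d hd')⟩
    have hinj : Set.InjOn f (Sᶜ : Finset W) := by
      intro d hd d' hd' h
      have hd : d ∉ S := by simpa using hd
      have hd' : d' ∉ S := by simpa using hd'
      have := hfs d' hd' (h ▸ hfd d hd)
      simpa [hd] using this
    have hc : (Sᶜ : Finset W).card + 3 = Fintype.card W := by
      rw [← h3 S hS, card_compl_add_card]
    have he : (T.erase S).card + 1 = T.card := card_erase_add_one hS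
    have hle := card_le_card_of_injOn f hmaps hinj
    have hsurj := surjOn_of_injOn_of_card_le f hmaps hinj (by omega)
    have hmem : ∀ S' ∈ T, S' ≠ S → ∃ d ∉ S, f d = S' := by
      intro S' hS' hne
      obtain ⟨d, hd, h⟩ := hsurj (show S' ∈ _ by simp [hS', hne])
      exact ⟨d, by simpa using hd, h⟩
    have huniq : ∀ S' ∈ T, ∀ d ∉ S, d ∈ S' → S' = f d := by
      intro S' hS' d hd hdS'
      obtain ⟨u, hu, rfl⟩ := hmem S' hS' (fun h => hd (h ▸ hdS'))
      have := hfs u hu hdS'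
      rw [mem_insert, or_iff_left hd] at this
      rw [this]
    refine ⟨by omega, fun S' hS' hne => ?_, fun S' hS' S'' hS'' d hd h' h'' => ?_⟩
    · obtain ⟨d, hd, rfl⟩ := hmem S' hS' hne
      exact ⟨d, hd, hfd d hd, hfs d hd⟩
    · rw [huniq S' hS' d hd h', huniq S'' hS'' d hd h'']
  obtain ⟨S, hS⟩ := hne
  refine ⟨(key S hS).1, ?_⟩
  -- With a single member any two of its points serve. Otherwise the pair is the intersection of `S`
  -- with a second member.
  by_cases hall : ∀ S' ∈ T, S' = S
  · obtain ⟨a, b, c, hab, hac, hbc, rfl⟩ := card_eq_three.1 (h3 S hS)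
    exact ⟨a, b, c, hab, hac, hbc, hS, fun S' hS' => by simp [hall S' hS']⟩
  push Not at hall
  obtain ⟨S₁, hS₁, hne⟩ := hall
  obtain ⟨d, hd, hd₁, hs₁⟩ := (key S hS).2.1 S₁ hS₁ hne
  have hsub : S₁.erase d ⊆ S := fun x hx => by
    have := hs₁ (mem_of_mem_erase hx)
    simpa [ne_of_mem_erase hx] using this
  have hcard : (S₁.erase d).card = 2 := by rw [card_erase_of_mem hd₁, h3 S₁ hS₁]
  obtain ⟨a, b, hab, he⟩ := card_eq_two.1 hcard
  have haS : a ∈ S := hsub (by simp [he])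
  have hbS : b ∈ S := hsub (by simp [he])
  have ha₁ : a ∈ S₁ := mem_of_mem_erase (a := d) (by simp [he])
  have hb₁ : b ∈ S₁ := mem_of_mem_erase (a := d) (by simp [he])
  have hS₁' : ∀ x ∈ S₁, x = d ∨ x = a ∨ x = b := by
    intro x hx
    by_cases h : x = d
    · exact Or.inl h
    · have : x ∈ S₁.erase d := mem_erase.2 ⟨h, hx⟩
      rw [he] at this
      simpa [h] using this
  have hda : d ≠ a := fun h => hd (h ▸ haS)
  have hdb : d ≠ b := fun h => hd (h ▸ hbS)
  have hSd : S₁ = {a, b, d} := by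
    ext x
    constructor
    · intro hx
      rcases hS₁' x hx with h | h | h <;> simp [h]
    · intro hx
      simp only [mem_insert, mem_singleton] at hx
      rcases hx with rfl | rfl | rfl <;> assumption
  refine ⟨a, b, d, hab, hda.symm, hdb.symm, hSd ▸ hS₁, fun S' hS' => ?_⟩
  by_cases h1 : S' = S₁
  · exact h1 ▸ ⟨ha₁, hb₁⟩
  by_cases h0 : S' = S
  · exact h0 ▸ ⟨haS, hbS⟩
  obtain ⟨u, hu, huS', hus⟩ := (key S hS).2.1 S' hS' h0
  obtain ⟨v, hv, hvS', hvs⟩ := (key S₁ hS₁).2.1 S' hS' h1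
  have e1 : S'.erase u ⊆ S := fun x hx => by
    have := hus (mem_of_mem_erase hx)
    simpa [ne_of_mem_erase hx] using this
  have e2 : S'.erase v ⊆ S₁ := fun x hx => by
    have := hvs (mem_of_mem_erase hx)
    simpa [ne_of_mem_erase hx] using this
  have hdS' : d ∉ S' := fun h => h1 ((key S hS).2.2 S' hS' S₁ hS₁ d hd h hd₁)
  -- If `u ≠ v`, then `u` lies in `S₁ = {a, b, d}`; but `d ∉ S'`, while `a` and `b` lie in `S` and
  -- `u` does not.
  have huv : u = v := by
    by_contra h
    have hu₁ : u ∈ S₁ := e2 (mem_erase.2 ⟨h, huS'⟩)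
    rcases hS₁' u hu₁ with rfl | rfl | rfl <;> contradiction
  subst huv
  have hsub2 : S'.erase u ⊆ {a, b} := by
    intro x hx
    have hx1 := e2 hx
    rcases hS₁' x hx1 with rfl | h
    · exact absurd (mem_of_mem_erase hx) hdS'
    · simpa using h
  have heq : S'.erase u = {a, b} := by
    apply eq_of_subset_of_card_le hsub2
    rw [card_erase_of_mem huS', h3 S' hS', card_pair hab]
  exact ⟨mem_of_mem_erase (a := u) (by simp [heq]), mem_of_mem_erase (a := u) (by simp [heq])⟩

/-! ### Gain matrices of complete graphs -/

theorem eisensteinOmega_sq : eisensteinOmega ^ 2 = eisensteinOmega - 1 := by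
  have h3 : ((Real.sqrt 3 : ℝ) : ℂ) ^ 2 = 3 := by
    rw [← Complex.ofReal_pow, Real.sq_sqrt (by norm_num)]
    norm_num
  unfold eisensteinOmega
  linear_combination (((Real.sqrt 3 : ℝ) : ℂ) ^ 2 / 4) * Complex.I_sq - (1 / 4) * h3

theorem eisensteinOmega_re : eisensteinOmega.re = 1 / 2 := by
  simp [eisensteinOmega]

theorem mul_star_of_pow_six {z : ℂ} (hz : z ^ 6 = 1) : z * star z = 1 := by
  have h : ‖z‖ = 1 := Complex.norm_eq_one_of_pow_eq_one hz (by norm_num)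
  rw [Complex.star_def, Complex.mul_conj, Complex.normSq_eq_norm_sq, h]
  norm_num

theorem star_eisensteinOmega : star eisensteinOmega = 1 - eisensteinOmega := by
  have h := mul_star_of_pow_six eisensteinOmega_pow_six
  have h' := eisensteinOmega_sq
  have hne : eisensteinOmega ≠ 0 := by
    intro h0
    simp [h0] at h
  apply mul_left_cancel₀ hne
  linear_combination h + h'

/-- Factor `z ^ 6 - 1` into linear factors; for the roots `-1`, `-ω` and `-ω̄` only the sign of the
real part matters. -/
theorem sixth_root_cases {z : ℂ} (hz : z ^ 6 = 1) :
    z = 1 ∨ z = eisensteinOmega ∨ z = star eisensteinOmega ∨ z.re ≤ 0 := by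
  have hq := eisensteinOmega_sq
  have hre := eisensteinOmega_re
  rw [star_eisensteinOmega]
  have : (z - 1) * ((z - eisensteinOmega) * ((z - (1 - eisensteinOmega)) *
      ((z + 1) * ((z + eisensteinOmega) * (z + (1 - eisensteinOmega)))))) = 0 := by
    have e1 : (z - eisensteinOmega) * (z - (1 - eisensteinOmega)) = z ^ 2 - z + 1 := by
      linear_combination -hq
    have e2 : (z + eisensteinOmega) * (z + (1 - eisensteinOmega)) = z ^ 2 + z + 1 := by
      linear_combination -hq
    linear_combination hz + (z - 1) * (z + 1) * (z + eisensteinOmega) *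
      (z + (1 - eisensteinOmega)) * e1 + (z - 1) * (z + 1) * (z ^ 2 - z + 1) * e2
  simp only [mul_eq_zero] at this
  rcases this with h | h | h | h | h | h
  · exact Or.inl (sub_eq_zero.1 h)
  · exact Or.inr (Or.inl (sub_eq_zero.1 h))
  · exact Or.inr (Or.inr (Or.inl (sub_eq_zero.1 h)))
  all_goals
    rw [add_eq_zero_iff_eq_neg] at h
    refine Or.inr (Or.inr (Or.inr ?_))
    simp [h, hre]
  norm_num

theorem re_le_half_of_pow_six {z : ℂ} (hz : z ^ 6 = 1) (h1 : z ≠ 1) : z.re ≤ 1 / 2 := by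
  rcases sixth_root_cases hz with h | h | h | h
  · exact absurd h h1
  · rw [h, eisensteinOmega_re]
  · rw [h, Complex.star_def, Complex.conj_re, eisensteinOmega_re]
  · linarith

theorem eq_omega_or_star_of_re_eq_half {z : ℂ} (hz : z ^ 6 = 1) (h : z.re = 1 / 2) :
    z = eisensteinOmega ∨ z = star eisensteinOmega := by
  rcases sixth_root_cases hz with h' | h' | h' | h'
  · norm_num [h'] at h
  · exact Or.inl h'
  · exact Or.inr h'
  · linarith

/-- The Eisenstein matrices of complete graphs with gains in `𝕋₆`. -/
structure IsCompleteGainMatrix {V : Type*} (E : Matrix V V ℂ) : Prop where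
  diag : ∀ i, E i i = 0
  symm : ∀ i j, E j i = star (E i j)
  pow_six : ∀ i j, i ≠ j → E i j ^ 6 = 1

/-- The gain of the closed walk `i j k i`. -/
noncomputable def triangleGain {V : Type*} (E : Matrix V V ℂ) (i j k : V) : ℂ := E i j * E j k * E k i

/-- The ordered triples of distinct vertices. -/
def distinctTriples (V : Type*) [Fintype V] [DecidableEq V] : Finset (V × V × V) :=
  univ.filter fun p => p.1 ≠ p.2.1 ∧ p.2.1 ≠ p.2.2 ∧ p.2.2 ≠ p.1

/-- The total deficit of the triangles, taken over ordered triples. -/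
noncomputable def triangleDeficit {V : Type*} [Fintype V] [DecidableEq V] (E : Matrix V V ℂ) : ℝ :=
  ∑ p ∈ distinctTriples V, (1 - (triangleGain E p.1 p.2.1 p.2.2).re)

open scoped Classical in
/-- The ordered triples of distinct vertices whose triangle has a gain other than `1`. -/
noncomputable def unbalancedTriples {V : Type*} [Fintype V] [DecidableEq V] (E : Matrix V V ℂ) :
    Finset (V × V × V) :=
  (distinctTriples V).filter fun p => triangleGain E p.1 p.2.1 p.2.2 ≠ 1

theorem triangleGain_rotate {V : Type*} (E : Matrix V V ℂ) (i j k : V) :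
    triangleGain E j k i = triangleGain E i j k := by
  simp only [triangleGain]; ring

theorem trace_cube_re {V : Type*} [Fintype V] [DecidableEq V] (E : Matrix V V ℂ) :
    (E ^ 3).trace.re = ∑ p : V × V × V, (triangleGain E p.1 p.2.1 p.2.2).re := by
  simp only [Fintype.sum_prod_type, triangleGain, ← Complex.re_sum]
  congr 1
  simp only [Matrix.trace, Matrix.diag, pow_succ, pow_zero, one_mul, Matrix.mul_apply,
    Finset.sum_mul]
  refine sum_congr rfl fun i _ => ?_
  rw [sum_comm]

/-! ### Triangle gains, switching at a vertex, and the deficit -/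

namespace IsCompleteGainMatrix

variable {V : Type*} {E : Matrix V V ℂ}

theorem mul_symm (hE : IsCompleteGainMatrix E) {i j : V} (h : i ≠ j) : E i j * E j i = 1 := by
  rw [hE.symm i j, mul_star_of_pow_six (hE.pow_six i j h)]

theorem triangleGain_pow_six (hE : IsCompleteGainMatrix E) {i j k : V} (hij : i ≠ j) (hjk : j ≠ k)
    (hki : k ≠ i) : triangleGain E i j k ^ 6 = 1 := by
  simp only [triangleGain, mul_pow, hE.pow_six i j hij, hE.pow_six j k hjk, hE.pow_six k i hki,
    mul_one]

theorem triangleGain_reverse (hE : IsCompleteGainMatrix E) (i j k : V) :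
    triangleGain E i k j = star (triangleGain E i j k) := by
  simp only [triangleGain, star_mul', ← hE.symm]; ring

theorem triangleGain_reverse_ne_one (hE : IsCompleteGainMatrix E) {i j k : V}
    (h : triangleGain E i j k ≠ 1) : triangleGain E i k j ≠ 1 := by
  rw [hE.triangleGain_reverse i j k]
  exact fun h' => h (by rw [← star_star (triangleGain E i j k), h', star_one])

/-- The triangles of a tetrahedron, suitably oriented, have total gain `1`. -/
theorem triangleGain_tetrahedron (hE : IsCompleteGainMatrix E) {i j k d : V} (hi : d ≠ i)
    (hj : d ≠ j) (hk : d ≠ k) :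
    triangleGain E d i j * triangleGain E d j k * triangleGain E d k i = triangleGain E i j k := by
  have h1 := hE.mul_symm hi
  have h2 := hE.mul_symm hj
  have h3 := hE.mul_symm hk
  simp only [triangleGain]
  linear_combination E i j * E j k * E k i * (E d j * E j d * E d k * E k d * h1 +
    E d k * E k d * h2 + h3)

/-- Switching with respect to the gains at the vertex `c`. -/
theorem apply_eq_switch (hE : IsCompleteGainMatrix E) {c i j : V} (hi : i ≠ c) (hj : j ≠ c) :
    E i j = E i c * triangleGain E c i j * star (E j c) := by
  have h1 := hE.mul_symm hi
  have h2 := hE.mul_symm hj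
  rw [← hE.symm]
  simp only [triangleGain]
  linear_combination -E i j * E j c * E c j * h1 - E i j * h2

/-- Switch by the gains towards a root `c`: each edge `ij` off `c` then carries the gain of the
triangle `c i j`, which is `1`. -/
theorem exists_switch_of_balanced (hE : IsCompleteGainMatrix E)
    (h : ∀ i j k, i ≠ j → j ≠ k → k ≠ i → triangleGain E i j k = 1) :
    ∃ x : V → ℂ, (∀ i, x i ^ 6 = 1) ∧ ∀ i j, i ≠ j → E i j = x i * star (x j) := by
  classical
  rcases isEmpty_or_nonempty V with hV | ⟨⟨c⟩⟩
  · exact ⟨fun _ => 1, fun _ => one_pow 6, fun i => hV.elim i⟩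
  refine ⟨fun i => if i = c then 1 else E i c, fun i => ?_, fun i j hij => ?_⟩
  · dsimp only
    split_ifs with hi
    · simp
    · exact hE.pow_six i c hi
  · by_cases hi : i = c
    · subst hi
      simp [hij.symm, ← hE.symm]
    · by_cases hj : j = c
      · subst hj
        simp [hij]
      · simp only [hi, hj, if_false]
        rw [hE.apply_eq_switch hi hj, h c i j (Ne.symm hi) hij hj, mul_one]

variable [Fintype V] [DecidableEq V]

/-- Degenerate triples use a diagonal entry, so they contribute nothing to the trace. Hence the
deficit is a spectral invariant among complete gain graphs. -/
theorem triangleDeficit_eq (hE : IsCompleteGainMatrix E) :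
    triangleDeficit E = (distinctTriples V).card - (E ^ 3).trace.re := by
  rw [triangleDeficit, sum_sub_distrib, trace_cube_re]
  congr 1
  · simp
  · apply sum_subset (subset_univ _)
    rintro ⟨i, j, k⟩ - h
    simp only [distinctTriples, mem_filter, mem_univ, true_and, ne_eq, not_and_or, not_not] at h
    rcases h with h | h | h <;> simp [triangleGain, h, hE.diag]

theorem sum_unbalancedTriples (E : Matrix V V ℂ) :
    ∑ p ∈ unbalancedTriples E, (1 - (triangleGain E p.1 p.2.1 p.2.2).re) = triangleDeficit E := by
  apply sum_subset (filter_subset _ _)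
  intro p hp h
  simp only [mem_filter, hp, true_and, ne_eq, not_not] at h
  simp [h]

theorem half_le_of_mem_unbalancedTriples (hE : IsCompleteGainMatrix E) {p : V × V × V}
    (hp : p ∈ unbalancedTriples E) : 1 / 2 ≤ 1 - (triangleGain E p.1 p.2.1 p.2.2).re := by
  simp only [unbalancedTriples, distinctTriples, mem_filter, mem_univ, true_and] at hp
  have := re_le_half_of_pow_six (hE.triangleGain_pow_six hp.1.1 hp.1.2.1 hp.1.2.2) hp.2
  linarith

theorem card_unbalancedTriples_le (hE : IsCompleteGainMatrix E) :
    ((unbalancedTriples E).card : ℝ) ≤ 2 * triangleDeficit E := by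
  rw [← sum_unbalancedTriples E]
  have := card_nsmul_le_sum (unbalancedTriples E) _ (1 / 2 : ℝ)
    fun p hp => hE.half_le_of_mem_unbalancedTriples hp
  rw [nsmul_eq_mul] at this
  linarith

/-- If there are at least `2 D` unbalanced triples, where `D` is the deficit, all their gains have
real part `1 / 2`. -/
theorem re_eq_half (hE : IsCompleteGainMatrix E)
    (h : 2 * triangleDeficit E ≤ (unbalancedTriples E).card) {p : V × V × V}
    (hp : p ∈ unbalancedTriples E) : (triangleGain E p.1 p.2.1 p.2.2).re = 1 / 2 := by
  have h0 : ∑ p ∈ unbalancedTriples E, (1 - (triangleGain E p.1 p.2.1 p.2.2).re - 1 / 2) ≤ 0 := by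
    rw [sum_sub_distrib, sum_unbalancedTriples E, sum_const, nsmul_eq_mul]
    linarith
  have hn : ∀ p ∈ unbalancedTriples E,
      0 ≤ 1 - (triangleGain E p.1 p.2.1 p.2.2).re - 1 / 2 := fun p hp =>
    sub_nonneg.2 (hE.half_le_of_mem_unbalancedTriples hp)
  have := (sum_eq_zero_iff_of_nonneg hn).1 (le_antisymm h0 (sum_nonneg hn)) p hp
  linarith

end IsCompleteGainMatrix

open scoped Classical in
/-- The gain of `ij` in `K_n^*`, where the edge from `a` to `b` is oriented. -/
noncomputable def starGain {V : Type*} (a b i j : V) : ℂ :=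
  if i = a ∧ j = b then eisensteinOmega
  else if i = b ∧ j = a then star eisensteinOmega
  else 1

/-! ### Unbalanced triangles and recognition of `K_n^*` -/

namespace IsCompleteGainMatrix

variable {V : Type*} {E : Matrix V V ℂ}

theorem exists_switch_starGain (hE : IsCompleteGainMatrix E) {a b c : V} (hab : a ≠ b)
    (hac : a ≠ c) (hbc : b ≠ c) (hω : triangleGain E c a b = eisensteinOmega)
    (h : ∀ i j k, i ≠ j → j ≠ k → k ≠ i → triangleGain E i j k ≠ 1 →
      (a = i ∨ a = j ∨ a = k) ∧ (b = i ∨ b = j ∨ b = k)) :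
    ∃ x : V → ℂ, (∀ i, x i ^ 6 = 1) ∧ ∀ i j, i ≠ j → E i j = x i * starGain a b i j * star (x j) := by
  classical
  refine ⟨fun i => if i = c then 1 else E i c, fun i => ?_, fun i j hij => ?_⟩
  · dsimp only
    split_ifs with hi
    · simp
    · exact hE.pow_six i c hi
  · by_cases hi : i = c
    · subst hi
      simp [hij.symm, ← hE.symm, starGain, hac.symm, hbc.symm]
    · by_cases hj : j = c
      · subst hj
        simp [hij, starGain, hac.symm, hbc.symm]
      · simp only [hi, hj, if_false]
        rw [hE.apply_eq_switch hi hj]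
        congr 2
        unfold starGain
        split_ifs with h1 h2
        · rw [h1.1, h1.2, hω]
        · rw [h2.1, h2.2, hE.triangleGain_reverse, hω]
        -- An unbalanced triangle `c i j` contains both `a` and `b`, and `c` is neither, so `ij` is
        -- `ab` or `ba`.
        · by_contra hne
          obtain ⟨h3, h4⟩ := h c i j (Ne.symm hi) hij hj hne
          rcases h3 with rfl | rfl | rfl
          · exact hac rfl
          · rcases h4 with rfl | rfl | rfl
            · exact hbc rfl
            · exact hab rfl
            · exact h1 ⟨rfl, rfl⟩
          · rcases h4 with rfl | rfl | rfl
            · exact hbc rfl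
            · exact h2 ⟨rfl, rfl⟩
            · exact hab rfl

variable [Fintype V] [DecidableEq V]

theorem mem_unbalancedTriples {i j k : V} : (i, j, k) ∈ unbalancedTriples E ↔
    (i ≠ j ∧ j ≠ k ∧ k ≠ i) ∧ triangleGain E i j k ≠ 1 := by
  simp [unbalancedTriples, distinctTriples]

theorem rotate_mem {i j k : V} (h : (i, j, k) ∈ unbalancedTriples E) :
    (j, k, i) ∈ unbalancedTriples E := by
  rw [mem_unbalancedTriples] at h ⊢
  rw [triangleGain_rotate]
  tauto

theorem reverse_mem (hE : IsCompleteGainMatrix E) {i j k : V}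
    (h : (i, j, k) ∈ unbalancedTriples E) : (i, k, j) ∈ unbalancedTriples E := by
  rw [mem_unbalancedTriples] at h ⊢
  exact ⟨⟨h.1.2.2.symm, h.1.2.1.symm, h.1.1.symm⟩, hE.triangleGain_reverse_ne_one h.2⟩

/-- The vertex sets of the unbalanced triangles. -/
noncomputable def unbalancedSets (E : Matrix V V ℂ) : Finset (Finset V) :=
  (unbalancedTriples E).image fun p => {p.1, p.2.1, p.2.2}

theorem mem_unbalancedSets {S : Finset V} : S ∈ unbalancedSets E ↔
    ∃ i j k, (i, j, k) ∈ unbalancedTriples E ∧ S = {i, j, k} := by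
  simp [unbalancedSets, eq_comm]

theorem mem_unbalancedTriples_of_set (hE : IsCompleteGainMatrix E) {i j k : V} (hij : i ≠ j)
    (hjk : j ≠ k) (hki : k ≠ i) (h : {i, j, k} ∈ unbalancedSets E) :
    (i, j, k) ∈ unbalancedTriples E := by
  obtain ⟨a, b, c, hm, he⟩ := mem_unbalancedSets.1 h
  have hi : i ∈ ({a, b, c} : Finset V) := he ▸ by simp
  have hj : j ∈ ({a, b, c} : Finset V) := he ▸ by simp
  have hk : k ∈ ({a, b, c} : Finset V) := he ▸ by simp
  simp only [mem_insert, mem_singleton] at hi hj hk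
  have h1 := rotate_mem hm
  have h2 := rotate_mem h1
  have h3 := hE.reverse_mem hm
  have h4 := hE.reverse_mem h1
  have h5 := hE.reverse_mem h2
  rcases hi with rfl | rfl | rfl <;> rcases hj with rfl | rfl | rfl <;>
    rcases hk with rfl | rfl | rfl <;> first | contradiction | assumption

/-- Rotation and reversal preserve being unbalanced, so all six orderings of each set occur. -/
theorem six_mul_card_unbalancedSets_le (hE : IsCompleteGainMatrix E) :
    6 * (unbalancedSets E).card ≤ (unbalancedTriples E).card := by
  apply mul_card_image_le_card
  rintro S hS
  obtain ⟨i, j, k, hm, rfl⟩ := mem_unbalancedSets.1 hS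
  have h1 := rotate_mem hm
  have h2 := rotate_mem h1
  have h3 := hE.reverse_mem hm
  have h4 := hE.reverse_mem h1
  have h5 := hE.reverse_mem h2
  obtain ⟨hij, hjk, hki⟩ := (mem_unbalancedTriples.1 hm).1
  have hcard : ({(i, j, k), (j, k, i), (k, i, j), (i, k, j), (j, i, k), (k, j, i)} :
      Finset (V × V × V)).card = 6 := by
    simp [hij, hjk, hki, hij.symm, hjk.symm, hki.symm]
  rw [← hcard]
  apply card_le_card
  intro p hp
  simp only [mem_insert, mem_singleton] at hp
  rw [mem_filter]
  have hr : ∀ u v w : V, ({v, w, u} : Finset V) = {u, v, w} := fun u v w => by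
    rw [insert_comm u v, pair_comm u w]
  have hs : ∀ u v w : V, ({u, w, v} : Finset V) = {u, v, w} := fun u v w => by
    rw [pair_comm]
  rcases hp with rfl | rfl | rfl | rfl | rfl | rfl
  · exact ⟨hm, rfl⟩
  · exact ⟨h1, hr i j k⟩
  · exact ⟨h2, (hr k i j).symm⟩
  · exact ⟨h3, hs i j k⟩
  · exact ⟨h4, insert_comm j i {k}⟩
  · exact ⟨h5, (hs k i j).trans (hr k i j).symm⟩

theorem card_of_mem_unbalancedSets {S : Finset V} (hS : S ∈ unbalancedSets E) : S.card = 3 := by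
  obtain ⟨i, j, k, hm, rfl⟩ := mem_unbalancedSets.1 hS
  obtain ⟨hij, hjk, hki⟩ := (mem_unbalancedTriples.1 hm).1
  exact card_eq_three.2 ⟨i, j, k, hij, hki.symm, hjk, rfl⟩

/-- The gain of `S` is the product of the gains of the three triangles joining `d` to its sides, so
these are not all `1`. -/
theorem exchange_unbalancedSets (hE : IsCompleteGainMatrix E) {S : Finset V}
    (hS : S ∈ unbalancedSets E) {d : V} (hd : d ∉ S) :
    ∃ S' ∈ unbalancedSets E, d ∈ S' ∧ S' ⊆ insert d S := by
  obtain ⟨i, j, k, hm, rfl⟩ := mem_unbalancedSets.1 hS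
  obtain ⟨⟨hij, hjk, hki⟩, hne⟩ := mem_unbalancedTriples.1 hm
  simp only [mem_insert, mem_singleton, not_or] at hd
  obtain ⟨hi, hj, hk⟩ := hd
  have key : ∀ u v, d ≠ u → d ≠ v → u ≠ v → u ∈ ({i, j, k} : Finset V) →
      v ∈ ({i, j, k} : Finset V) → triangleGain E d u v ≠ 1 →
      ∃ S' ∈ unbalancedSets E, d ∈ S' ∧ S' ⊆ insert d {i, j, k} := by
    intro u v hu hv huv hu' hv' h
    refine ⟨{d, u, v}, mem_unbalancedSets.2 ⟨d, u, v,
      mem_unbalancedTriples.2 ⟨⟨hu, huv, hv.symm⟩, h⟩, rfl⟩, by simp, ?_⟩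
    apply insert_subset_insert
    intro x hx
    rcases mem_insert.1 hx with rfl | hx
    · exact hu'
    · exact mem_singleton.1 hx ▸ hv'
  by_cases h1 : triangleGain E d i j = 1
  · by_cases h2 : triangleGain E d j k = 1
    · by_cases h3 : triangleGain E d k i = 1
      · have := hE.triangleGain_tetrahedron hi hj hk
        rw [h1, h2, h3] at this
        exact absurd (by simpa using this.symm) hne
      · exact key k i hk hi hki (by simp) (by simp) h3
    · exact key j k hj hk hjk (by simp) (by simp) h2
  · exact key i j hi hj hij (by simp) (by simp) h1

/-- A complete gain graph with vanishing deficit switches to `K_n`. -/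
theorem exists_switch_of_deficit_eq_zero (hE : IsCompleteGainMatrix E)
    (h : triangleDeficit E = 0) :
    ∃ x : V → ℂ, (∀ i, x i ^ 6 = 1) ∧ ∀ i j, i ≠ j → E i j = x i * star (x j) := by
  apply hE.exists_switch_of_balanced
  intro i j k hij hjk hki
  by_contra hne
  have := hE.card_unbalancedTriples_le
  rw [h, mul_zero] at this
  have h0 : (unbalancedTriples E).card = 0 := by exact_mod_cast le_antisymm this (by positivity)
  rw [card_eq_zero] at h0
  have hm := mem_unbalancedTriples.2 ⟨⟨hij, hjk, hki⟩, hne⟩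
  simp [h0] at hm

/-- A complete gain graph with the deficit of `K_n^*` switches to a copy of `K_n^*`. -/
theorem exists_switch_of_deficit_eq (hE : IsCompleteGainMatrix E) (hV : 2 ≤ Fintype.card V)
    (h : triangleDeficit E = 3 * ((Fintype.card V : ℝ) - 2)) :
    ∃ a b : V, a ≠ b ∧ ∃ x : V → ℂ, (∀ i, x i ^ 6 = 1) ∧
      ∀ i j, i ≠ j → E i j = x i * starGain a b i j * star (x j) := by
  have hω := mul_star_of_pow_six eisensteinOmega_pow_six
  -- For `n = 2` there are no triangles; the single edge is switched to gain `ω` directly.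
  rcases hV.eq_or_lt with h2 | h3
  · obtain ⟨a, b, hab, hu⟩ := card_eq_two.1 (h2.symm.trans rfl : (univ : Finset V).card = 2)
    refine ⟨a, b, hab, fun i => if i = a then E a b * star eisensteinOmega else 1,
      fun i => ?_, fun i j hij => ?_⟩
    · dsimp only
      split_ifs
      · rw [mul_pow, hE.pow_six a b hab, ← star_pow, eisensteinOmega_pow_six]
        simp
      · simp
    · have hi : i ∈ ({a, b} : Finset V) := hu ▸ mem_univ i
      have hj : j ∈ ({a, b} : Finset V) := hu ▸ mem_univ j
      simp only [mem_insert, mem_singleton] at hi hj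
      rcases hi with rfl | rfl <;> rcases hj with rfl | rfl
      · exact absurd rfl hij
      · simp only [starGain, hij.symm, if_true, if_false, and_self, star_one]
        linear_combination -E i j * hω
      · simp only [starGain, hij, if_true, if_false, and_self, false_and, star_mul', star_star,
          ← hE.symm]
        linear_combination -E i j * hω
      · exact absurd rfl hij
  have hle := hE.card_unbalancedTriples_le
  have h6 := hE.six_mul_card_unbalancedSets_le
  -- With `D` the deficit, `6 |T| ≤ #triples ≤ 2 D = 6 (n - 2)`.
  have hT : (unbalancedSets E).card + 2 ≤ Fintype.card V := by
    have h6' : (6 * (unbalancedSets E).card : ℝ) ≤ (unbalancedTriples E).card := by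
      exact_mod_cast h6
    have : ((unbalancedSets E).card : ℝ) + 2 ≤ Fintype.card V := by linarith
    exact_mod_cast this
  have hne : (unbalancedSets E).Nonempty := by
    by_contra hemp
    rw [not_nonempty_iff_eq_empty, unbalancedSets, image_eq_empty] at hemp
    have := sum_unbalancedTriples E
    rw [hemp, sum_empty, h] at this
    have h3' : (3 : ℝ) ≤ Fintype.card V := by exact_mod_cast h3
    linarith
  obtain ⟨hcard, a, b, c, hab, hac, hbc, hmem, hall⟩ := exists_common_pair_of_exchange
    (unbalancedSets E) (fun S hS => card_of_mem_unbalancedSets hS) hT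
    (fun S hS d hd => hE.exchange_unbalancedSets hS hd) hne
  have hm := hE.mem_unbalancedTriples_of_set hab hbc hac.symm hmem
  have hre := hE.re_eq_half (by
    have h6' : (6 * (unbalancedSets E).card : ℝ) ≤ (unbalancedTriples E).card := by
      exact_mod_cast h6
    have : ((unbalancedSets E).card : ℝ) + 2 = Fintype.card V := by exact_mod_cast hcard
    linarith) hm
  have hall' : ∀ i j k, i ≠ j → j ≠ k → k ≠ i → triangleGain E i j k ≠ 1 →
      (a = i ∨ a = j ∨ a = k) ∧ (b = i ∨ b = j ∨ b = k) := by
    intro i j k hij hjk hki hne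
    simpa using hall {i, j, k} (mem_unbalancedSets.2
      ⟨i, j, k, mem_unbalancedTriples.2 ⟨⟨hij, hjk, hki⟩, hne⟩, rfl⟩)
  dsimp only at hre
  rw [triangleGain_rotate E c a b] at hre
  -- A conjugate gain means that the arc runs from `b` to `a`; exchanging their roles makes the
  -- converse unnecessary.
  rcases eq_omega_or_star_of_re_eq_half
    (hE.triangleGain_pow_six hac.symm hab hbc) hre with hz | hz
  · exact ⟨a, b, hab, hE.exists_switch_starGain hab hac hbc hz hall'⟩
  · refine ⟨b, a, hab.symm, hE.exists_switch_starGain hab.symm hbc hac ?_ fun i j k hij hjk hki hne =>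
      (hall' i j k hij hjk hki hne).symm⟩
    rw [hE.triangleGain_reverse, hz, star_star]

end IsCompleteGainMatrix

/-! ### Signed digraphs and their Eisenstein matrices -/

theorem T6.coe_pow_six (z : T6) : ((z : ℂˣ) : ℂ) ^ 6 = 1 := by
  rw [← Units.val_pow_eq_pow_val, (mem_rootsOfUnity 6 _).1 z.2, Units.val_one]

theorem T6.coe_inv (z : T6) : (((z⁻¹ : T6) : ℂˣ) : ℂ) = star ((z : ℂˣ) : ℂ) := by
  have h := mul_star_of_pow_six (T6.coe_pow_six z)
  rw [InvMemClass.coe_inv, Units.val_inv_eq_inv_val]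
  exact inv_eq_of_mul_eq_one_right h

namespace SignedDigraph

variable {V : Type u} {W : Type v}

theorem eisenstein_of_adj (Φ : SignedDigraph V) {a b : V} (h : Φ.graph.Adj a b) :
    Φ.eisenstein a b = ((Φ.gain ⟨(a, b), h⟩ : ℂˣ) : ℂ) := by
  simp [eisenstein, h]

theorem eisenstein_of_not_adj (Φ : SignedDigraph V) {a b : V} (h : ¬ Φ.graph.Adj a b) :
    Φ.eisenstein a b = 0 := by
  simp [eisenstein, h]

theorem eisenstein_diag (Φ : SignedDigraph V) (a : V) : Φ.eisenstein a a = 0 :=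
  Φ.eisenstein_of_not_adj (Φ.graph.irrefl)

theorem eisenstein_pow_six (Φ : SignedDigraph V) {a b : V} (h : Φ.graph.Adj a b) :
    Φ.eisenstein a b ^ 6 = 1 := by
  rw [Φ.eisenstein_of_adj h, T6.coe_pow_six]

theorem eisenstein_symm (Φ : SignedDigraph V) (a b : V) :
    Φ.eisenstein b a = star (Φ.eisenstein a b) := by
  by_cases h : Φ.graph.Adj a b
  · rw [Φ.eisenstein_of_adj h, Φ.eisenstein_of_adj h.symm, ← T6.coe_inv, ← Φ.gain_symm]
    rfl
  · rw [Φ.eisenstein_of_not_adj h, Φ.eisenstein_of_not_adj fun h' => h h'.symm, star_zero]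

theorem isHermitian_eisenstein (Φ : SignedDigraph V) : Φ.eisenstein.IsHermitian := by
  ext a b
  rw [Matrix.conjTranspose_apply, ← Φ.eisenstein_symm]

theorem isCompleteGainMatrix (Φ : SignedDigraph V) (h : ∀ a b, a ≠ b → Φ.graph.Adj a b) :
    IsCompleteGainMatrix Φ.eisenstein where
  diag := Φ.eisenstein_diag
  symm := Φ.eisenstein_symm
  pow_six a b hab := Φ.eisenstein_pow_six (h a b hab)

theorem eisenstein_neg (Φ : SignedDigraph V) : Φ.neg.eisenstein = -Φ.eisenstein := by
  ext a b
  by_cases h : Φ.graph.Adj a b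
  · rw [Matrix.neg_apply, Φ.eisenstein_of_adj h,
      Φ.neg.eisenstein_of_adj (show Φ.neg.graph.Adj a b from h)]
    simp [neg, T6.negOne]
  · rw [Matrix.neg_apply, Φ.eisenstein_of_not_adj h,
      Φ.neg.eisenstein_of_not_adj (show ¬ Φ.neg.graph.Adj a b from h), neg_zero]

/-- Transport of a signed digraph along a bijection of the vertex sets. -/
def relabel (e : V ≃ W) (Φ : SignedDigraph V) : SignedDigraph W where
  graph := Φ.graph.comap e.symm
  gain d := Φ.gain ⟨(e.symm d.fst, e.symm d.snd), d.adj⟩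
  gain_symm d := Φ.gain_symm ⟨(e.symm d.fst, e.symm d.snd), d.adj⟩

theorem isRelabeling_relabel (e : V ≃ W) (Φ : SignedDigraph V) :
    IsRelabeling e Φ (Φ.relabel e) := by
  ext a b
  by_cases h : Φ.graph.Adj (e.symm a) (e.symm b)
  · rw [(Φ.relabel e).eisenstein_of_adj (show (Φ.relabel e).graph.Adj a b from h)]
    rw [Matrix.reindex_apply, Matrix.submatrix_apply, Φ.eisenstein_of_adj h]
    rfl
  · rw [(Φ.relabel e).eisenstein_of_not_adj (show ¬ (Φ.relabel e).graph.Adj a b from h)]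
    rw [Matrix.reindex_apply, Matrix.submatrix_apply, Φ.eisenstein_of_not_adj h]

theorem switchingIsomorphic_of_switch [Fintype W] [DecidableEq W]
    {Φ : SignedDigraph V} {Ψ : SignedDigraph W} (e : V ≃ W)
    (x : W → ℂ) (hx : ∀ i, x i ^ 6 = 1)
    (h : ∀ i j, Ψ.eisenstein i j = x i * Φ.eisenstein (e.symm i) (e.symm j) * star (x j)) :
    SwitchingIsomorphic Φ Ψ := by
  refine ⟨e, Φ.relabel e, Ψ, isRelabeling_relabel e Φ, Relation.ReflTransGen.single (Or.inl ?_),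
    Or.inl rfl⟩
  refine ⟨fun i => rootsOfUnity.mkOfPowEq (x i) (hx i), ?_⟩
  have hinv : (Matrix.diagonal x)⁻¹ = Matrix.diagonal (star x) := by
    apply Matrix.inv_eq_right_inv
    rw [Matrix.diagonal_mul_diagonal, ← Matrix.diagonal_one]
    congr 1
    ext i
    exact mul_star_of_pow_six (hx i)
  simp only [rootsOfUnity.coe_mkOfPowEq]
  rw [hinv]
  ext i j
  rw [Matrix.mul_diagonal, Matrix.diagonal_mul, isRelabeling_relabel e Φ, h]
  rfl

theorem normSq_eisenstein (Φ : SignedDigraph V) {a b : V} (h : Φ.graph.Adj a b) :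
    Complex.normSq (Φ.eisenstein a b) = 1 := by
  have := mul_star_of_pow_six (Φ.eisenstein_pow_six h)
  rw [Complex.star_def, Complex.mul_conj] at this
  exact_mod_cast this

theorem complete_eisenstein {i j : V} (h : i ≠ j) : (complete V).eisenstein i j = 1 := by
  rw [(complete V).eisenstein_of_adj (show (complete V).graph.Adj i j from h)]
  simp [complete]

theorem completeStar_eisenstein {a b : V} (hab : a ≠ b) {i j : V} (h : i ≠ j) :
    (completeStar a b hab).eisenstein i j = starGain a b i j := by
  rw [(completeStar a b hab).eisenstein_of_adj
    (show (completeStar a b hab).graph.Adj i j from h)]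
  simp only [completeStar, starGain]
  by_cases h1 : (i, j) = (a, b)
  · rw [if_pos h1, if_pos (Prod.mk_inj.1 h1)]
    simp [T6.omega]
  rw [if_neg h1, if_neg (mt Prod.mk_inj.2 h1)]
  by_cases h2 : (i, j) = (b, a)
  · rw [if_pos h2, if_pos (Prod.mk_inj.1 h2), T6.coe_inv]
    simp [T6.omega]
  · rw [if_neg h2, if_neg (mt Prod.mk_inj.2 h2)]
    simp

/-! ### Spectral moments and determination by them -/

section Finite

variable [Fintype V] [DecidableEq V]

theorem trace_sq_re (Φ : SignedDigraph V) :
    (Φ.eisenstein ^ 2).trace.re = ∑ p : V × V, Complex.normSq (Φ.eisenstein p.1 p.2) := by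
  simp only [Fintype.sum_prod_type, Matrix.trace, Matrix.diag, pow_two, Matrix.mul_apply,
    Complex.re_sum]
  refine sum_congr rfl fun i _ => sum_congr rfl fun j _ => ?_
  rw [Φ.eisenstein_symm i j, Complex.star_def, Complex.mul_conj, Complex.ofReal_re]

/-- A signed digraph with as many edges as a complete one is complete. -/
theorem adj_of_trace_sq_eq {Φ Ψ : SignedDigraph V} (hΦ : ∀ a b, a ≠ b → Φ.graph.Adj a b)
    (h : (Φ.eisenstein ^ 2).trace = (Ψ.eisenstein ^ 2).trace) {a b : V} (hab : a ≠ b) :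
    Ψ.graph.Adj a b := by
  have h' := congrArg Complex.re h
  rw [trace_sq_re, trace_sq_re] at h'
  -- Termwise domination with equal sums forces equality in every term.
  have hle : ∀ p ∈ (univ : Finset (V × V)), Complex.normSq (Ψ.eisenstein p.1 p.2) ≤
      Complex.normSq (Φ.eisenstein p.1 p.2) := by
    rintro ⟨i, j⟩ -
    by_cases hij : Ψ.graph.Adj i j
    · rw [Ψ.normSq_eisenstein hij, Φ.normSq_eisenstein (hΦ i j hij.ne)]
    · rw [Ψ.eisenstein_of_not_adj hij, map_zero]
      exact Complex.normSq_nonneg _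
  have := (sum_eq_sum_iff_of_le hle).1 h'.symm (a, b) (mem_univ _)
  by_contra hn
  rw [Ψ.eisenstein_of_not_adj hn, Φ.normSq_eisenstein (hΦ a b hab), map_zero] at this
  exact zero_ne_one this

theorem triangleDeficit_complete : triangleDeficit (complete V).eisenstein = 0 := by
  apply sum_eq_zero
  rintro ⟨i, j, k⟩ h
  simp only [distinctTriples, mem_filter, mem_univ, true_and] at h
  simp [triangleGain, complete_eisenstein h.1, complete_eisenstein h.2.1,
    complete_eisenstein h.2.2]

set_option linter.unusedSimpArgs false in
theorem triangleDeficit_completeStar {a b : V} (hab : a ≠ b) :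
    triangleDeficit (completeStar a b hab).eisenstein = 3 * ((Fintype.card V : ℝ) - 2) := by
  -- `P` marks the oriented edge in both directions and `N` marks distinct pairs. A triple has
  -- deficit `1/2` exactly when one of its three sides is that edge, whence the three cyclic terms
  -- below, with equal sums.
  let P : V → V → ℝ := fun i j => (if i = a ∧ j = b then 1 else 0) + if i = b ∧ j = a then 1 else 0
  let N : V → V → ℝ := fun i j => if i = j then 0 else 1
  have hre := eisensteinOmega_re
  have hP : ∀ i, P i i = 0 := fun i => by
    simp only [P]
    rw [if_neg (fun h => hab (h.1.symm.trans h.2)), if_neg (fun h => hab (h.2.symm.trans h.1)),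
      add_zero]
  have h1 : triangleDeficit (completeStar a b hab).eisenstein =
      ∑ i, ∑ j, ∑ k, 1 / 2 * (P i j * N j k * N k i + P j k * N k i * N i j
        + P k i * N i j * N j k) := by
    rw [triangleDeficit, distinctTriples, sum_filter, Fintype.sum_prod_type]
    refine sum_congr rfl fun i _ => ?_
    rw [Fintype.sum_prod_type]
    refine sum_congr rfl fun j _ => sum_congr rfl fun k _ => ?_
    by_cases hij : i = j
    · simp [N, hij, hP]
    by_cases hjk : j = k
    · simp [N, hjk, hP]
    by_cases hki : k = i
    · simp [N, hki, hP]
    rw [if_pos ⟨hij, hjk, hki⟩]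
    simp only [triangleGain, completeStar_eisenstein hab hij, completeStar_eisenstein hab hjk,
      completeStar_eisenstein hab hki, N, hij, hjk, hki, if_false, mul_one, P, starGain]
    by_cases hia : i = a
    · subst hia
      by_cases hjb : j = b
      · subst hjb
        simp [hij, hjk, hki, Ne.symm hij, Ne.symm hjk, Ne.symm hki, hre]
        norm_num
      · by_cases hkb : k = b
        · subst hkb
          simp [hij, hjk, hki, Ne.symm hij, Ne.symm hjk, Ne.symm hki, hre]
          norm_num
        · simp [hij, hjk, hki, Ne.symm hij, Ne.symm hjk, Ne.symm hki, hjb, hkb]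
    · by_cases hja : j = a
      · subst hja
        by_cases hib : i = b
        · subst hib
          simp [hij, hjk, hki, Ne.symm hij, Ne.symm hjk, Ne.symm hki, hre]
          norm_num
        · by_cases hkb : k = b
          · subst hkb
            simp [hij, hjk, hki, Ne.symm hij, Ne.symm hjk, Ne.symm hki, hre]
            norm_num
          · simp [hij, hjk, hki, Ne.symm hij, Ne.symm hjk, Ne.symm hki, hib, hkb]
      · by_cases hka : k = a
        · subst hka
          by_cases hib : i = b
          · subst hib
            simp [hij, hjk, hki, Ne.symm hij, Ne.symm hjk, Ne.symm hki, hre]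
            norm_num
          · by_cases hjb : j = b
            · subst hjb
              simp [hij, hjk, hki, Ne.symm hij, Ne.symm hjk, Ne.symm hki, hre]
              norm_num
            · simp [hij, hjk, hki, Ne.symm hij, Ne.symm hjk, Ne.symm hki, hib, hjb]
        · simp [hia, hja, hka]
  have hN : ∀ u v : V, u ≠ v → ∑ k, N u k * N k v = (Fintype.card V : ℝ) - 2 := by
    intro u v huv
    have : ∀ k, N u k * N k v = 1 - (if u = k then 1 else 0) - (if k = v then 1 else 0) := by
      intro k
      simp only [N]
      by_cases hu : u = k
      · subst hu; simp [huv]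
      · by_cases hv : k = v
        · simp [hv, huv]
        · simp [hu, hv]
    simp [this, sum_sub_distrib]
    ring
  have h2 : ∑ i, ∑ j, ∑ k, P i j * N j k * N k i = 2 * ((Fintype.card V : ℝ) - 2) := by
    have : ∀ i j, ∑ k, P i j * N j k * N k i = P i j * ((Fintype.card V : ℝ) - 2) := by
      intro i j
      by_cases hij : j = i
      · simp [hij, hP]
      · simp only [mul_assoc, ← mul_sum, hN j i hij]
    simp only [this, ← sum_mul]
    congr 1
    simp only [P, ite_and, sum_add_distrib, ← sum_ite_irrel]
    simp
    norm_num
  have h3 : ∑ i, ∑ j, ∑ k, P j k * N k i * N i j = ∑ i, ∑ j, ∑ k, P i j * N j k * N k i := by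
    rw [sum_comm]
    exact sum_congr rfl fun j _ => sum_comm
  have h4 : ∑ i, ∑ j, ∑ k, P k i * N i j * N j k = ∑ i, ∑ j, ∑ k, P i j * N j k * N k i := by
    rw [← h3]
    rw [sum_comm]
    exact sum_congr rfl fun j _ => sum_comm
  rw [h1]
  simp only [← mul_sum, sum_add_distrib]
  rw [h3, h4, h2]
  ring

/-- Every signed digraph on the same vertex set with the same second and third spectral moments
arises by a relabeling and a switching. -/
def IsDeterminedByMoments (Φ : SignedDigraph V) : Prop :=
  ∀ Ψ : SignedDigraph V, (Φ.eisenstein ^ 2).trace = (Ψ.eisenstein ^ 2).trace →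
    (Φ.eisenstein ^ 3).trace = (Ψ.eisenstein ^ 3).trace →
    ∃ (e : V ≃ V) (x : V → ℂ), (∀ i, x i ^ 6 = 1) ∧ ∀ i j,
      Ψ.eisenstein i j = x i * Φ.eisenstein (e.symm i) (e.symm j) * star (x j)

theorem IsDeterminedByMoments.neg {Φ : SignedDigraph V} (h : Φ.IsDeterminedByMoments) :
    Φ.neg.IsDeterminedByMoments := by
  intro Ψ h2 h3
  rw [eisenstein_neg, neg_sq] at h2
  rw [eisenstein_neg, Odd.neg_pow (by decide), Matrix.trace_neg] at h3
  obtain ⟨e, x, hx, hΨ⟩ := h Ψ.neg (by rw [h2, eisenstein_neg, neg_sq])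
    (by rw [eisenstein_neg, Odd.neg_pow (by decide), Matrix.trace_neg, ← h3, neg_neg])
  refine ⟨e, x, hx, fun i j => ?_⟩
  have := hΨ i j
  rw [eisenstein_neg, Matrix.neg_apply] at this
  rw [eisenstein_neg, Matrix.neg_apply]
  linear_combination -this

/-- The degree of the characteristic polynomial gives the number of vertices, so `Ψ` can be moved to
`V`; Hermitian matrices with equal characteristic polynomials have equal moments. -/
theorem IsDeterminedByMoments.isDES {Φ : SignedDigraph V} (h : Φ.IsDeterminedByMoments) :
    IsDES.{u, v} Φ := by
  intro W _ _ Ψ hc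
  have hcard : Fintype.card V = Fintype.card W := by
    rw [← Φ.eisenstein.charpoly_natDegree_eq_dim, hc, Ψ.eisenstein.charpoly_natDegree_eq_dim]
  let e₀ : V ≃ W := Fintype.equivOfCardEq hcard
  have hrel := isRelabeling_relabel e₀.symm Ψ
  have hc' : Φ.eisenstein.charpoly = (Ψ.relabel e₀.symm).eisenstein.charpoly := by
    rw [hrel, Matrix.charpoly_reindex]
    exact hc
  have htr := Φ.isHermitian_eisenstein.trace_pow_eq_of_charpoly_eq
    (Ψ.relabel e₀.symm).isHermitian_eisenstein hc'
  obtain ⟨e, x, hx, hΨ⟩ := h _ (htr 2) (htr 3)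
  refine switchingIsomorphic_of_switch (e.trans e₀) (x ∘ e₀.symm) (fun i => hx _) fun i j => ?_
  have := hΨ (e₀.symm i) (e₀.symm j)
  rw [hrel] at this
  simpa using this

theorem triangleDeficit_eq_of_trace_eq {Φ Ψ : SignedDigraph V}
    (hΦ : IsCompleteGainMatrix Φ.eisenstein) (hΨ : IsCompleteGainMatrix Ψ.eisenstein)
    (h : (Φ.eisenstein ^ 3).trace = (Ψ.eisenstein ^ 3).trace) :
    triangleDeficit Ψ.eisenstein = triangleDeficit Φ.eisenstein := by
  rw [hΦ.triangleDeficit_eq, hΨ.triangleDeficit_eq, h]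

theorem isDeterminedByMoments_complete : (complete V).IsDeterminedByMoments := by
  intro Ψ h2 h3
  have hΨ := Ψ.isCompleteGainMatrix fun a b hab => adj_of_trace_sq_eq (fun _ _ h => h) h2 hab
  obtain ⟨x, hx, h⟩ := hΨ.exists_switch_of_deficit_eq_zero (by
    rw [triangleDeficit_eq_of_trace_eq ((complete V).isCompleteGainMatrix fun _ _ h => h) hΨ h3,
      triangleDeficit_complete])
  refine ⟨Equiv.refl V, x, hx, fun i j => ?_⟩
  by_cases hij : i = j
  · subst hij
    simp [eisenstein_diag]
  · rw [h i j hij]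
    simp [complete_eisenstein hij]

theorem isDeterminedByMoments_completeStar {a b : V} (hab : a ≠ b) :
    (completeStar a b hab).IsDeterminedByMoments := by
  intro Ψ h2 h3
  have hΨ := Ψ.isCompleteGainMatrix fun a b hab => adj_of_trace_sq_eq (fun _ _ h => h) h2 hab
  have hV : 2 ≤ Fintype.card V := Fintype.one_lt_card_iff.2 ⟨a, b, hab⟩
  obtain ⟨c, d, hcd, x, hx, h⟩ := hΨ.exists_switch_of_deficit_eq hV (by
    rw [triangleDeficit_eq_of_trace_eq
      ((completeStar a b hab).isCompleteGainMatrix fun _ _ h => h) hΨ h3,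
      triangleDeficit_completeStar])
  obtain ⟨e, hea, heb⟩ : ∃ e : Equiv.Perm V, e a = c ∧ e b = d := by
    -- The first swap sends `a` to `c`; the second sends the image of `b` to `d` and fixes `c`,
    -- which differs from both.
    refine ⟨(Equiv.swap a c).trans (Equiv.swap (Equiv.swap a c b) d), ?_, by simp⟩
    have h1 : c ≠ Equiv.swap a c b := fun h' => hab <| by
      rw [← Equiv.swap_apply_left a c] at h'
      exact (Equiv.swap a c).injective (by simpa using h')
    simp [Equiv.swap_apply_of_ne_of_ne h1 hcd]
  refine ⟨e, x, hx, fun i j => ?_⟩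
  by_cases hij : i = j
  · subst hij
    simp [eisenstein_diag]
  · rw [h i j hij, completeStar_eisenstein hab (e.symm.injective.ne hij)]
    simp only [starGain, Equiv.symm_apply_eq, hea, heb]
    congr

end Finite
end SignedDigraph

theorem mainTheorem9 {V : Type u} [Fintype V] [DecidableEq V] :
    SignedDigraph.IsDES.{u, v} (SignedDigraph.complete V) ∧
    (∀ (a b : V) (hab : a ≠ b),
      SignedDigraph.IsDES.{u, v} (SignedDigraph.completeStar a b hab)) ∧
    SignedDigraph.IsDES.{u, v} (SignedDigraph.complete V).neg ∧
    (∀ (a b : V) (hab : a ≠ b),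
      SignedDigraph.IsDES.{u, v} (SignedDigraph.completeStar a b hab).neg) :=
  ⟨SignedDigraph.isDeterminedByMoments_complete.isDES,
    fun _ _ hab => (SignedDigraph.isDeterminedByMoments_completeStar hab).isDES,
    SignedDigraph.isDeterminedByMoments_complete.neg.isDES,
    fun _ _ hab => (SignedDigraph.isDeterminedByMoments_completeStar hab).neg.isDES⟩
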